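/- All quantum systems are finite-dimensional, nonzero complex Hilbert spaces, and $L(\mathcal{H}_A)$ denotes the linear operators on $\mathcal{H}_A$. A linear map $\mathcal{N}:L(\mathcal{H}_A)\to L(\mathcal{H}_B)$ is called HPTP if it maps Hermitian operators to Hermitian operators and preserves the trace. It is called CPTP if it preserves the trace and is completely positive, i.e. $\mathrm{id}_R\otimes\mathcal{N}$ maps positive semidefinite operators to positive semidefinite operators for every finite-dimensional system $R$. The physical implementability of an HPTP map $\mathcal{N}$ is $$\nu(\mathcal{N}):=\log_2\min\Big\{\sum_\alpha|\eta_\alpha| \;:\; \mathcal{N}=\sum_\alpha\eta_\alpha\mathcal{O}_\alpha,\ \eta_\alpha\in\mathbb{R},\ \mathcal{O}_\alpha:L(\mathcal{H}_A)\to L(\mathcal{H}_B)\text{ CPTP}\Big\},$$ where the sums are finite. **Theorem (Additivity with respect to tensor products).** Let $\mathcal{M}:L(\mathcal{H}_{A_1})\to L(\mathcal{H}_{B_1})$ and $\mathcal{N}:L(\mathcal{H}_{A_2})\to L(\mathcal{H}_{B_2})$ be HPTP maps. Then the minima defining $\nu(\mathcal{M})$, $\nu(\mathcal{N})$ and $\nu(\mathcal{M}\otimes\mathcal{N})$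 exist and are positive, and $$\nu(\mathcal{M}\otimes\mathcal{N})=\nu(\mathcal{M})+\nu(\mathcal{N}).$$ -/

import Mathlib

open scoped Kronecker ComplexOrder

namespace LinearMapImplementability

/-- Linear maps from operators on `ℂ^A` to operators on `ℂ^B`, for finite index types `A` and `B`
(orthonormal bases of the input and output systems). -/
abbrev SuperOp (A B : Type*) : Type _ := Matrix A A ℂ →ₗ[ℂ] Matrix B B ℂ

/-- The tensor product `M ⊗ N` of two linear maps, acting on the operators of the composite system
`ℂ^(A₁ × A₂) = ℂ^A₁ ⊗ ℂ^A₂`. -/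
noncomputable def tensorMap {A₁ B₁ A₂ B₂ : Type*}
    [Fintype A₁] [DecidableEq A₁] [Fintype B₁] [DecidableEq B₁]
    [Fintype A₂] [DecidableEq A₂] [Fintype B₂] [DecidableEq B₂]
    (M : SuperOp A₁ B₁) (N : SuperOp A₂ B₂) : SuperOp (A₁ × A₂) (B₁ × B₂) :=
  (kroneckerLinearEquiv B₁ B₁ B₂ B₂ ℂ).toLinearMap ∘ₗ
    TensorProduct.map M N ∘ₗ (kroneckerLinearEquiv A₁ A₁ A₂ A₂ ℂ).symm.toLinearMap

/-- `M ⊗ N` is determined by `(M ⊗ N)(X ⊗ Y) = M(X) ⊗ N(Y)`. -/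
theorem tensorMap_kronecker {A₁ B₁ A₂ B₂ : Type*}
    [Fintype A₁] [DecidableEq A₁] [Fintype B₁] [DecidableEq B₁]
    [Fintype A₂] [DecidableEq A₂] [Fintype B₂] [DecidableEq B₂]
    (M : SuperOp A₁ B₁) (N : SuperOp A₂ B₂) (X : Matrix A₁ A₁ ℂ) (Y : Matrix A₂ A₂ ℂ) :
    tensorMap M N (X ⊗ₖ Y) = M X ⊗ₖ N Y := by
  simp [tensorMap]

/-- Trace-preserving maps. -/
def IsTracePreserving {A B : Type*} [Fintype A] [Fintype B] (N : SuperOp A B) : Prop :=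
  ∀ X : Matrix A A ℂ, (N X).trace = X.trace

/-- Hermitian-preserving maps. -/
def IsHermitianPreserving {A B : Type*} (N : SuperOp A B) : Prop :=
  ∀ X : Matrix A A ℂ, X.IsHermitian → (N X).IsHermitian

/-- Positive maps: they send positive semidefinite operators to positive semidefinite operators. -/
def IsPositiveMap {A B : Type*} (N : SuperOp A B) : Prop :=
  ∀ X : Matrix A A ℂ, X.PosSemidef → (N X).PosSemidef

/-- Completely positive maps: `id_R ⊗ N` is positive for every finite-dimensional reference
system `R = ℂ^k`. -/
def IsCompletelyPositive {A B : Type*} [Fintype A] [DecidableEq A] [Fintype B] [DecidableEq B]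
    (N : SuperOp A B) : Prop :=
  ∀ k : ℕ, IsPositiveMap (tensorMap (LinearMap.id : SuperOp (Fin k) (Fin k)) N)

/-- Quantum channels. -/
def IsCPTP {A B : Type*} [Fintype A] [DecidableEq A] [Fintype B] [DecidableEq B]
    (N : SuperOp A B) : Prop :=
  IsCompletelyPositive N ∧ IsTracePreserving N

/-- Hermitian- and trace-preserving maps. -/
def IsHPTP {A B : Type*} [Fintype A] [Fintype B] (N : SuperOp A B) : Prop :=
  IsHermitianPreserving N ∧ IsTracePreserving N

/-- All values `∑ |η_α|` over the finite decompositions `N = ∑ η_α O_α` with `η_α` real and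
`O_α` CPTP. -/
def decompositionCosts {A B : Type*} [Fintype A] [DecidableEq A] [Fintype B] [DecidableEq B]
    (N : SuperOp A B) : Set ℝ :=
  {c | ∃ (n : ℕ) (η : Fin n → ℝ) (O : Fin n → SuperOp A B),
    (∀ α, IsCPTP (O α)) ∧ N = ∑ α, (η α : ℂ) • O α ∧ c = ∑ α, |η α|}

/-- The physical implementability `ν(N)`: the base-two logarithm of the least decomposition
cost. -/
noncomputable def physicalImplementability {A B : Type*}
    [Fintype A] [DecidableEq A] [Fintype B] [DecidableEq B] (N : SuperOp A B) : ℝ :=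
  Real.logb 2 (sInf (decompositionCosts N))

end LinearMapImplementability

/-! Multiplicativity of the minimal cost has an easy half: tensoring decompositions of `M` and `N`
multiplies costs. The other half is semidefinite duality, with dual certificates that also multiply.

Collecting the positive and the negative coefficients writes a trace-preserving `N` as `(1 + b) P -
b Q` with `P`, `Q` channels, at cost `1 + 2b`. On Choi matrices this asks for `K ≥ 0` with `K + J ≥
0` and partial trace `b • 1`, where `J = choi N`; the least `b` exists by compactness.

A certificate is a pair `R > 0`, `W` with `-R ⊗ 1 ≤ W ≤ R ⊗ 1`. The Choi matrix of a channel pairs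
with `W` to at most `tr R` in absolute value, so `tr (J W) / tr R` bounds every cost from below. By
Hahn-Banach and a Jordan decomposition, certificates reach every value below the minimum
(`IsHPTP.exists_witness`). The bounds on `W` survive Kronecker products
(`posSemidef_kronecker_sub_and_add`) and the pairings multiply, so the product of the two minima is
a lower bound for `M ⊗ N`. -/

namespace Matrix

/-! ### Positive semidefinite matrices and trace pairings -/

section Norm

open scoped MatrixOrder Matrix.Norms.L2Operator

variable {n : Type*} [Fintype n] [DecidableEq n]

theorem IsHermitian.posSemidef_smul_one_sub {H : Matrix n n ℂ} (hH : H.IsHermitian) {δ : ℝ}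
    (hδ : ‖H‖ ≤ δ) : ((δ : ℂ) • (1 : Matrix n n ℂ) - H).PosSemidef := by
  have h : H ≤ algebraMap ℝ (Matrix n n ℂ) δ :=
    (IsSelfAdjoint.le_algebraMap_norm_self (a := H) hH).trans (algebraMap_mono _ hδ)
  rw [Matrix.le_iff] at h
  rwa [Algebra.algebraMap_eq_smul_one, ← Complex.coe_smul] at h

theorem PosSemidef.norm_le_trace {A : Matrix n n ℂ} (hA : A.PosSemidef) : ‖A‖ ≤ A.trace.re := by
  have h : A.trace.re = ∑ i, hA.1.eigenvalues i := by
    rw [hA.1.trace_eq_sum_eigenvalues]; simp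
  have h0 : ∀ i, 0 ≤ hA.1.eigenvalues i := hA.eigenvalues_nonneg
  have hU := hA.1.eigenvectorUnitary.2
  have hs : A = hA.1.eigenvectorUnitary.1 * diagonal (RCLike.ofReal ∘ hA.1.eigenvalues) *
      star hA.1.eigenvectorUnitary.1 := by
    conv_lhs => rw [hA.1.spectral_theorem, Unitary.conjStarAlgAut_apply]
  have hn : ‖A‖ = ‖(diagonal (RCLike.ofReal ∘ hA.1.eigenvalues) : Matrix n n ℂ)‖ :=
    (congrArg norm hs).trans <| (CStarRing.norm_mul_mem_unitary _ (Unitary.star_mem hU)).trans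
      (CStarRing.norm_mem_unitary_mul _ hU)
  rw [h, hn, l2_opNorm_diagonal, pi_norm_le_iff_of_nonneg (Finset.sum_nonneg fun i _ => h0 i)]
  intro i
  simpa [abs_of_nonneg (h0 i)] using
    Finset.single_le_sum (fun i _ => h0 i) (Finset.mem_univ i)

theorem isClosed_setOf_posSemidef : IsClosed {A : Matrix n n ℂ | A.PosSemidef} := by
  simp_rw [← Matrix.nonneg_iff_posSemidef]
  exact isClosed_Ici

end Norm

variable {n : Type*} [Fintype n]

theorem PosSemidef.exists_eq_conjTranspose_mul_self [DecidableEq n] {A : Matrix n n ℂ}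
    (hA : A.PosSemidef) : ∃ B : Matrix n n ℂ, A = Bᴴ * B := by
  open scoped MatrixOrder in
  exact CStarAlgebra.nonneg_iff_eq_star_mul_self.mp hA.nonneg

theorem PosSemidef.re_trace_mul_nonneg {A B : Matrix n n ℂ} (hA : A.PosSemidef)
    (hB : B.PosSemidef) : 0 ≤ (A * B).trace.re := by
  classical
  obtain ⟨C, rfl⟩ := hB.exists_eq_conjTranspose_mul_self
  rw [← Matrix.mul_assoc, Matrix.trace_mul_comm, ← Matrix.mul_assoc]
  exact (Complex.nonneg_iff.1 (hA.mul_mul_conjTranspose_same C).trace_nonneg).1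

/-- Self-duality of the positive cone; rank-one test matrices suffice. -/
theorem IsHermitian.posSemidef_of_re_trace_mul_nonneg {A : Matrix n n ℂ} (hA : A.IsHermitian)
    (h : ∀ P : Matrix n n ℂ, P.PosSemidef → 0 ≤ (A * P).trace.re) : A.PosSemidef := by
  refine .of_dotProduct_mulVec_nonneg hA fun x => ?_
  have h1 := h _ (posSemidef_vecMulVec_self_star x)
  rw [mul_vecMulVec, trace_vecMulVec, dotProduct_comm] at h1
  refine Complex.nonneg_iff.2 ⟨h1, ?_⟩
  have := hA.im_star_dotProduct_mulVec_self x
  simpa using this.symm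

/-- Jordan decomposition of a Hermitian matrix `K = P - Q` together with its sign `U`. -/
theorem IsHermitian.exists_jordan_decomposition [DecidableEq n] {K : Matrix n n ℂ}
    (hK : K.IsHermitian) :
    ∃ P Q U : Matrix n n ℂ, P.PosSemidef ∧ Q.PosSemidef ∧ (1 - U).PosSemidef ∧
      (1 + U).PosSemidef ∧ K = P - Q ∧ (K * U).trace = P.trace + Q.trace := by
  set V : Matrix n n ℂ := hK.eigenvectorUnitary.1
  set l := hK.eigenvalues
  have hV : Vᴴ * V = 1 := Unitary.coe_star_mul_self hK.eigenvectorUnitary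
  have hV' : V * Vᴴ = 1 := Unitary.coe_mul_star_self hK.eigenvectorUnitary
  have hKV : K = V * diagonal (fun i => (l i : ℂ)) * Vᴴ := by
    conv_lhs => rw [hK.spectral_theorem, Unitary.conjStarAlgAut_apply]
    rfl
  have key : ∀ d : n → ℝ, (∀ i, 0 ≤ d i) →
      (V * diagonal (fun i => (d i : ℂ)) * Vᴴ).PosSemidef := fun d hd =>
    (PosSemidef.diagonal fun i => by simpa using hd i).mul_mul_conjTranspose_same V
  have tr : ∀ d : n → ℂ, (V * diagonal d * Vᴴ).trace = ∑ i, d i := fun d => by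
    rw [trace_mul_comm, ← Matrix.mul_assoc, hV, Matrix.one_mul, trace_diagonal]
  -- The sign chosen at a zero eigenvalue is immaterial, since only `l i * s i` matters.
  let s : n → ℝ := fun i => if 0 ≤ l i then 1 else -1
  have one_eq : (1 : Matrix n n ℂ) = V * diagonal (fun _ => ((1 : ℝ) : ℂ)) * Vᴴ := by
    simp [hV']
  refine ⟨V * diagonal (fun i => ((max (l i) 0 : ℝ) : ℂ)) * Vᴴ,
    V * diagonal (fun i => ((max (-l i) 0 : ℝ) : ℂ)) * Vᴴ,
    V * diagonal (fun i => (s i : ℂ)) * Vᴴ, key _ fun i => le_max_right _ _,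
    key _ fun i => le_max_right _ _, ?_, ?_, ?_, ?_⟩
  · rw [one_eq, ← Matrix.sub_mul, ← Matrix.mul_sub, diagonal_sub]
    simp_rw [← Complex.ofReal_sub]
    refine key (fun i => 1 - s i) fun i => ?_
    simp only [s]; split_ifs <;> norm_num
  · rw [one_eq, ← Matrix.add_mul, ← Matrix.mul_add, diagonal_add]
    simp_rw [← Complex.ofReal_add]
    refine key (fun i => 1 + s i) fun i => ?_
    simp only [s]; split_ifs <;> norm_num
  · rw [← Matrix.sub_mul, ← Matrix.mul_sub, diagonal_sub]
    simp_rw [← Complex.ofReal_sub]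
    rw [hKV]
    congr 4
    ext i
    congr 1
    rcases le_total 0 (l i) with h | h <;> simp [h]
  · have : K * (V * diagonal (fun i => (s i : ℂ)) * Vᴴ) =
        V * diagonal (fun i => ((l i * s i : ℝ) : ℂ)) * Vᴴ := by
      calc _ = V * diagonal (fun i => (l i : ℂ)) * (Vᴴ * V) * diagonal (fun i => (s i : ℂ)) * Vᴴ := by
            rw [hKV]; simp only [Matrix.mul_assoc]
        _ = _ := by
            rw [hV, Matrix.mul_one, Matrix.mul_assoc V, diagonal_mul_diagonal]
            simp
    rw [this, tr, tr, tr, ← Finset.sum_add_distrib]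
    refine Finset.sum_congr rfl fun i _ => ?_
    rw [← Complex.ofReal_add]
    congr 1
    simp only [s]
    split_ifs with h
    · simp [h]
    · simp [(not_le.1 h).le]

theorem PosSemidef.coe_re_trace {A : Matrix n n ℂ} (hA : A.PosSemidef) :
    (A.trace.re : ℂ) = A.trace :=
  Complex.ext (by simp) (by simpa using (Complex.nonneg_iff.1 hA.trace_nonneg).2)

theorem IsHermitian.coe_re_trace_mul {A B : Matrix n n ℂ} (hA : A.IsHermitian)
    (hB : B.IsHermitian) : ((A * B).trace.re : ℂ) = (A * B).trace := by
  rw [← Complex.conj_eq_iff_re, ← Complex.star_def, ← trace_conjTranspose, conjTranspose_mul,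
    hA.eq, hB.eq, trace_mul_comm]

/-- The real part of a complex linear functional is, on Hermitian matrices, the trace pairing with
a Hermitian matrix. -/
theorem exists_isHermitian_re_eq_re_trace_mul [DecidableEq n] (f : Matrix n n ℂ →ₗ[ℂ] ℂ) :
    ∃ R : Matrix n n ℂ, R.IsHermitian ∧
      ∀ X : Matrix n n ℂ, X.IsHermitian → (f X).re = (X * R).trace.re := by
  let F : Matrix n n ℂ := of fun i j => f (single j i 1)
  have hF : ∀ X, f X = (X * F).trace := fun X => by
    conv_lhs => rw [matrix_eq_sum_single X]
    simp only [map_sum, trace, diag_apply, mul_apply]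
    refine Finset.sum_congr rfl fun i _ => Finset.sum_congr rfl fun j _ => ?_
    have : single i j (X i j) = X i j • single i j (1 : ℂ) := by simp
    rw [this, map_smul, smul_eq_mul]
    rfl
  -- `F` represents `f` exactly; on Hermitian arguments its Hermitian part gives the real part.
  refine ⟨(1 / 2 : ℂ) • (F + Fᴴ), ?_, fun X hX => ?_⟩
  · rw [IsHermitian, conjTranspose_smul, conjTranspose_add, conjTranspose_conjTranspose, add_comm]
    simp
  · have h : (X * Fᴴ).trace = star (X * F).trace := by
      rw [← trace_conjTranspose, conjTranspose_mul, hX.eq, trace_mul_comm]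
    rw [hF, Matrix.mul_smul, trace_smul, Matrix.mul_add, trace_add, h, Complex.star_def,
      Complex.add_conj]
    simp

end Matrix

namespace LinearMapImplementability

open Matrix

/-! ### Choi matrices and the characterization of channels -/

section Choi

variable {A B : Type*}

/-- The partial trace over the second factor. -/
def partialTrace [Fintype B] : Matrix (A × B) (A × B) ℂ →ₗ[ℂ] Matrix A A ℂ where
  toFun J := of fun a a' => ∑ b, J (a, b) (a', b)
  map_add' X Y := by ext; simp [Finset.sum_add_distrib]
  map_smul' c X := by ext; simp [Finset.mul_sum]

theorem partialTrace_apply [Fintype B] (J : Matrix (A × B) (A × B) ℂ) (a a' : A) :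
    partialTrace J a a' = ∑ b, J (a, b) (a', b) := rfl

theorem trace_partialTrace [Fintype A] [Fintype B] (J : Matrix (A × B) (A × B) ℂ) :
    (partialTrace J).trace = J.trace := by
  simp [trace, partialTrace_apply, Fintype.sum_prod_type]

theorem trace_mul_kronecker_one [Fintype A] [Fintype B] [DecidableEq B]
    (J : Matrix (A × B) (A × B) ℂ) (R : Matrix A A ℂ) :
    (J * (R ⊗ₖ (1 : Matrix B B ℂ))).trace = (partialTrace J * R).trace := by
  simp only [trace, diag_apply, mul_apply, partialTrace_apply, Fintype.sum_prod_type,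
    kroneckerMap_apply, one_apply, mul_ite, mul_one, mul_zero, Finset.sum_ite_eq',
    Finset.mem_univ, if_true, Finset.sum_mul]
  exact Finset.sum_congr rfl fun a _ => Finset.sum_comm

theorem partialTrace_kronecker_one [Fintype B] [DecidableEq B] (R : Matrix A A ℂ) :
    partialTrace (R ⊗ₖ (1 : Matrix B B ℂ)) = (Fintype.card B : ℂ) • R := by
  ext a a'
  simp [partialTrace_apply]

theorem _root_.Matrix.PosSemidef.partialTrace [Fintype A] [Fintype B] {J : Matrix (A × B) (A × B) ℂ}
    (hJ : J.PosSemidef) : (LinearMapImplementability.partialTrace J).PosSemidef := by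
  have : LinearMapImplementability.partialTrace J =
      ∑ b, J.submatrix (fun a => (a, b)) (fun a => (a, b)) := by
    ext; simp [partialTrace_apply, Matrix.sum_apply]
  rw [this]
  exact posSemidef_sum _ fun b _ => hJ.submatrix _

/-- Both `X + Xᴴ` and `I • (X - Xᴴ)` are Hermitian, and together they determine `X`. -/
theorem IsHermitianPreserving.map_conjTranspose {N : SuperOp A B} (hN : IsHermitianPreserving N)
    (X : Matrix A A ℂ) : N Xᴴ = (N X)ᴴ := by
  have h1 : (N (X + Xᴴ))ᴴ = N (X + Xᴴ) := hN _ (by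
    rw [IsHermitian, conjTranspose_add, conjTranspose_conjTranspose, add_comm])
  have h2 : (N (Complex.I • (X - Xᴴ)))ᴴ = N (Complex.I • (X - Xᴴ)) := hN _ (by
    rw [IsHermitian, conjTranspose_smul, conjTranspose_sub, conjTranspose_conjTranspose,
      Complex.star_def, Complex.conj_I, neg_smul, ← smul_neg, neg_sub])
  rw [map_smul, conjTranspose_smul, Complex.star_def, Complex.conj_I, neg_smul, ← smul_neg] at h2
  have h3 := smul_right_injective _ Complex.I_ne_zero h2
  simp only [map_add, map_sub, conjTranspose_add, conjTranspose_sub] at h1 h3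
  ext i j
  have e1 := congrFun₂ h1 i j
  have e2 := congrFun₂ h3 i j
  simp only [Matrix.add_apply, Matrix.sub_apply, Matrix.neg_apply] at e1 e2
  linear_combination (1 / 2 : ℂ) * (e2 - e1)

variable [DecidableEq A]

/-- The Choi matrix `∑ |a⟩⟨a'| ⊗ N(|a⟩⟨a'|)` of a linear map. -/
def choi : SuperOp A B →ₗ[ℂ] Matrix (A × B) (A × B) ℂ where
  toFun N := of fun i j => N (single i.1 j.1 1) i.2 j.2
  map_add' X Y := by ext; simp
  map_smul' c X := by ext; simp

theorem choi_apply (N : SuperOp A B) (a a' : A) (b b' : B) :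
    choi N (a, b) (a', b') = N (single a a' 1) b b' := rfl

theorem IsHermitianPreserving.isHermitian_choi {N : SuperOp A B} (hN : IsHermitianPreserving N) :
    (choi N).IsHermitian := by
  ext ⟨a, b⟩ ⟨a', b'⟩
  rw [conjTranspose_apply, choi_apply, choi_apply, ← conjTranspose_apply, ← hN.map_conjTranspose]
  simp

variable [Fintype A]

theorem apply_eq_sum_choi (N : SuperOp A B) (X : Matrix A A ℂ) (b b' : B) :
    N X b b' = ∑ a, ∑ a', X a a' * choi N (a, b) (a', b') := by
  conv_lhs => rw [matrix_eq_sum_single X]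
  simp only [map_sum, Matrix.sum_apply, choi_apply]
  refine Finset.sum_congr rfl fun a _ => Finset.sum_congr rfl fun a' _ => ?_
  have : single a a' (X a a') = X a a' • single a a' (1 : ℂ) := by simp
  rw [this, map_smul, Matrix.smul_apply, smul_eq_mul]

theorem choi_injective : Function.Injective (choi (A := A) (B := B)) := fun M N h =>
  LinearMap.ext fun X => Matrix.ext fun b b' => by simp only [apply_eq_sum_choi, h]

theorem choi_surjective : Function.Surjective (choi (A := A) (B := B)) := fun J => by
  refine ⟨{ toFun := fun X => of fun b b' => ∑ a, ∑ a', X a a' * J (a, b) (a', b')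
            map_add' := fun X Y => by ext; simp [add_mul, Finset.sum_add_distrib]
            map_smul' := fun c X => by ext; simp [Finset.mul_sum, mul_assoc] }, ?_⟩
  ext ⟨a, b⟩ ⟨a', b'⟩
  rw [choi_apply]
  simp [single_apply, ite_and]

theorem isTracePreserving_iff [Fintype B] {N : SuperOp A B} :
    IsTracePreserving N ↔ partialTrace (choi N) = 1 := by
  constructor
  · intro h
    ext a a'
    have := h (single a a' 1)
    rw [partialTrace_apply]
    simp only [choi_apply]
    rw [one_apply]
    refine this.trans ?_
    split_ifs with h
    · subst h; simp
    · simp [trace_single_eq_of_ne _ _ _ h]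
  · intro h X
    have h1 : ∀ a a', ∑ b, choi N (a, b) (a', b) = if a = a' then 1 else 0 := fun a a' => by
      rw [← partialTrace_apply, h, one_apply]
    simp only [trace, diag_apply, apply_eq_sum_choi N X]
    rw [Finset.sum_comm]
    refine Finset.sum_congr rfl fun a _ => ?_
    rw [Finset.sum_comm]
    simp [← Finset.mul_sum, h1]

variable [Fintype B] [DecidableEq B]

theorem choi_tensorMap {A' B' : Type*} [Fintype A'] [DecidableEq A'] [Fintype B'] [DecidableEq B']
    (M : SuperOp A B) (N : SuperOp A' B') :
    choi M ⊗ₖ choi N = (choi (tensorMap M N)).submatrix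
      (Equiv.prodProdProdComm A B A' B') (Equiv.prodProdProdComm A B A' B') := by
  ext ⟨⟨a₁, b₁⟩, a₂, b₂⟩ ⟨⟨a₁', b₁'⟩, a₂', b₂'⟩
  simp only [submatrix_apply, Equiv.prodProdProdComm_apply, choi_apply, kroneckerMap_apply]
  rw [← mul_one (1 : ℂ), ← single_kronecker_single, tensorMap_kronecker]
  simp

theorem isPositiveMap_of_posSemidef_choi {N : SuperOp A B} (hN : (choi N).PosSemidef) :
    IsPositiveMap N := by
  intro X hX
  -- `V` sends `e_b` to `∑ a, e_a ⊗ e_a ⊗ e_b`, so compressing by it contracts `X` with the input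
  -- indices of the Choi matrix.
  let V : Matrix (A × A × B) B ℂ :=
    of fun i b => if i.1 = i.2.1 then (if i.2.2 = b then 1 else 0) else 0
  have : N X = Vᴴ * (X ⊗ₖ choi N) * V := by
    ext b b'
    simp [apply_eq_sum_choi N X, V, mul_apply, Fintype.sum_prod_type,
      apply_ite (star : ℂ → ℂ)]
    exact Finset.sum_comm
  rw [this]
  exact (hX.kronecker hN).conjTranspose_mul_mul_same V

theorem posSemidef_choi_tensorMap {A' B' : Type*} [Fintype A'] [DecidableEq A'] [Fintype B']
    [DecidableEq B'] {M : SuperOp A B} {N : SuperOp A' B'} (hM : (choi M).PosSemidef)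
    (hN : (choi N).PosSemidef) : (choi (tensorMap M N)).PosSemidef := by
  have := hM.kronecker hN
  rwa [choi_tensorMap, posSemidef_submatrix_equiv] at this

theorem posSemidef_choi_id : (choi (LinearMap.id : SuperOp A A)).PosSemidef := by
  have : choi (LinearMap.id : SuperOp A A) =
      vecMulVec (fun i => if i.1 = i.2 then 1 else 0) (star fun i => if i.1 = i.2 then 1 else 0) := by
    ext ⟨a, b⟩ ⟨a', b'⟩
    simp [choi_apply, single_apply, vecMulVec_apply, ite_and]
    split_ifs <;> simp
  rw [this]
  exact posSemidef_vecMulVec_self_star _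

/-- Choi's theorem. The Choi matrix is the image under `id ⊗ N` of the unnormalized maximally
entangled state, with a reference of dimension `card A`. Conversely, the Choi matrix of `id ⊗ N` is
a reindexed Kronecker product of positive semidefinite matrices. -/
theorem isCompletelyPositive_iff {N : SuperOp A B} :
    IsCompletelyPositive N ↔ (choi N).PosSemidef := by
  constructor
  · intro h
    let e := Fintype.equivFin A
    let v : Fin (Fintype.card A) × A → ℂ := fun i => if i.1 = e i.2 then 1 else 0
    have hv : vecMulVec v (star v) = ∑ a, ∑ a',
        single (e a) (e a') (1 : ℂ) ⊗ₖ single a a' (1 : ℂ) := by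
      ext ⟨i, a⟩ ⟨i', a'⟩
      simp [vecMulVec_apply, v, Matrix.sum_apply, single_apply, ite_and, eq_comm]
      split_ifs <;> rfl
    have h1 := (h _ _ (posSemidef_vecMulVec_self_star v)).submatrix
      (fun i : A × B => (e i.1, i.2))
    convert h1
    ext ⟨a, b⟩ ⟨a', b'⟩
    simp [hv, map_sum, tensorMap_kronecker, Matrix.sum_apply, choi_apply, single_apply, ite_and]
  · exact fun h k => isPositiveMap_of_posSemidef_choi (posSemidef_choi_tensorMap posSemidef_choi_id h)

theorem isCPTP_iff {N : SuperOp A B} :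
    IsCPTP N ↔ (choi N).PosSemidef ∧ partialTrace (choi N) = 1 :=
  and_congr isCompletelyPositive_iff isTracePreserving_iff

theorem IsTracePreserving.tensorMap {A' B' : Type*} [Fintype A'] [DecidableEq A'] [Fintype B']
    [DecidableEq B'] {M : SuperOp A B} {N : SuperOp A' B'} (hM : IsTracePreserving M)
    (hN : IsTracePreserving N) : IsTracePreserving (tensorMap M N) := by
  rw [isTracePreserving_iff] at *
  ext ⟨a₁, a₂⟩ ⟨a₁', a₂'⟩
  have h1 := congrFun₂ hM a₁ a₁'
  have h2 := congrFun₂ hN a₂ a₂'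
  rw [partialTrace_apply] at h1 h2 ⊢
  have key : ∀ b₁ b₂, choi (LinearMapImplementability.tensorMap M N) ((a₁, a₂), (b₁, b₂))
      ((a₁', a₂'), (b₁, b₂)) = choi M (a₁, b₁) (a₁', b₁) * choi N (a₂, b₂) (a₂', b₂) := fun b₁ b₂ =>
    (congrFun₂ (choi_tensorMap M N) ((a₁, b₁), (a₂, b₂)) ((a₁', b₁), (a₂', b₂))).symm
  rw [Fintype.sum_prod_type]
  simp only [key, ← Finset.mul_sum, ← Finset.sum_mul, h1, h2]
  exact congrFun₂ (one_kronecker_one (α := ℂ)) (a₁, a₂) (a₁', a₂')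

theorem IsCPTP.tensorMap {A' B' : Type*} [Fintype A'] [DecidableEq A'] [Fintype B']
    [DecidableEq B'] {M : SuperOp A B} {N : SuperOp A' B'} (hM : IsCPTP M) (hN : IsCPTP N) :
    IsCPTP (tensorMap M N) :=
  ⟨isCompletelyPositive_iff.2 (posSemidef_choi_tensorMap (isCompletelyPositive_iff.1 hM.1)
    (isCompletelyPositive_iff.1 hN.1)), hM.2.tensorMap hN.2⟩

end Choi

/-! ### The minimal cost as an attained semidefinite minimum -/

section NegativePart

variable {A B : Type*} [Fintype A] [DecidableEq A] [Fintype B]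

/-- `K` is the Choi matrix of the subtracted part in a splitting of `J` into a difference of
Choi matrices of multiples of channels, the subtracted one having weight `b`. -/
structure IsNegativePart (J K : Matrix (A × B) (A × B) ℂ) (b : ℝ) : Prop where
  posSemidef : K.PosSemidef
  posSemidef_add : (K + J).PosSemidef
  partialTrace_eq : partialTrace K = (b : ℂ) • (1 : Matrix A A ℂ)

variable {J K : Matrix (A × B) (A × B) ℂ} {b : ℝ}

theorem IsNegativePart.re_trace (h : IsNegativePart J K b) : K.trace.re = b * Fintype.card A := by
  rw [← trace_partialTrace, h.partialTrace_eq, trace_smul, trace_one]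
  simp

theorem IsNegativePart.nonneg [Nonempty A] (h : IsNegativePart J K b) : 0 ≤ b := by
  have h1 := (Complex.nonneg_iff.1 h.posSemidef.trace_nonneg).1
  rw [h.re_trace] at h1
  exact nonneg_of_mul_nonneg_left h1 (by exact_mod_cast Fintype.card_pos)

variable [DecidableEq B]

/-- Trace preservation forces `∑ η α = 1`. With `b` the total of the negative parts, the positive
parts add up to `1 + b`. -/
theorem exists_isNegativePart_of_mem_decompositionCosts [Nonempty A] {N : SuperOp A B}
    (hN : IsTracePreserving N) {c : ℝ} (hc : c ∈ decompositionCosts N) :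
    ∃ K b, IsNegativePart (choi N) K b ∧ c = 1 + 2 * b := by
  obtain ⟨n, η, O, hO, rfl, rfl⟩ := hc
  have hO' := fun α => isCPTP_iff.1 (hO α)
  have key : ∀ d : Fin n → ℝ, partialTrace (∑ α, (d α : ℂ) • choi (O α)) =
      ((∑ α, d α : ℝ) : ℂ) • (1 : Matrix A A ℂ) := fun d => by
    simp only [map_sum, map_smul, (hO' _).2, Complex.ofReal_sum, Finset.sum_smul]
  have pos : ∀ d : Fin n → ℝ, (∀ α, 0 ≤ d α) → (∑ α, (d α : ℂ) • choi (O α)).PosSemidef :=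
    fun d hd => posSemidef_sum _ fun α _ => (hO' α).1.smul (by simpa using hd α)
  have hJ : choi (∑ α, (η α : ℂ) • O α) = ∑ α, (η α : ℂ) • choi (O α) := by simp
  have hη : ∑ α, η α = 1 := by
    have h1 := isTracePreserving_iff.1 hN
    rw [hJ, key] at h1
    have := congrFun₂ h1 (Classical.arbitrary A) (Classical.arbitrary A)
    rw [Matrix.smul_apply, one_apply_eq, smul_eq_mul, mul_one] at this
    exact_mod_cast this
  refine ⟨∑ α, ((max (-η α) 0 : ℝ) : ℂ) • choi (O α), ∑ α, max (-η α) 0,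
    ⟨pos _ fun α => le_max_right _ _, ?_, key _⟩, ?_⟩
  · rw [hJ, ← Finset.sum_add_distrib]
    simp only [← add_smul, ← Complex.ofReal_add]
    refine pos _ fun α => ?_
    linarith [le_max_left (-η α) 0]
  · rw [← hη, Finset.mul_sum, ← Finset.sum_add_distrib]
    refine Finset.sum_congr rfl fun α _ => ?_
    rcases le_total 0 (η α) with h | h
    · rw [abs_of_nonneg h, max_eq_right (by linarith)]; ring
    · rw [abs_of_nonpos h, max_eq_left (by linarith)]; ring

theorem sum_abs_mem_decompositionCosts {ι : Type*} [Fintype ι] (η : ι → ℝ) (O : ι → SuperOp A B)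
    (hO : ∀ i, IsCPTP (O i)) :
    ∑ i, |η i| ∈ decompositionCosts (∑ i, (η i : ℂ) • O i) := by
  let e := (Fintype.equivFin ι).symm
  exact ⟨_, η ∘ e, O ∘ e, fun _ => hO _, (e.sum_comp fun i => (η i : ℂ) • O i).symm,
    (e.sum_comp fun i => |η i|).symm⟩

theorem IsNegativePart.mem_decompositionCosts [Nonempty A] {N : SuperOp A B}
    (hN : IsTracePreserving N) (h : IsNegativePart (choi N) K b) :
    1 + 2 * b ∈ decompositionCosts N := by
  have hb := h.nonneg
  have hJ := isTracePreserving_iff.1 hN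
  obtain ⟨P, hP⟩ := choi_surjective ((((1 + b)⁻¹ : ℝ) : ℂ) • (K + choi N))
  have hb1 : 0 < 1 + b := by linarith
  have hPc : IsCPTP P := by
    rw [isCPTP_iff, hP]
    refine ⟨h.posSemidef_add.smul (Complex.zero_le_real.2 (by positivity)), ?_⟩
    have : (b : ℂ) • (1 : Matrix A A ℂ) + 1 = ((1 + b : ℝ) : ℂ) • (1 : Matrix A A ℂ) := by
      rw [Complex.ofReal_add, Complex.ofReal_one, add_smul, one_smul, add_comm]
    rw [map_smul, map_add, hJ, h.partialTrace_eq, this, smul_smul, ← Complex.ofReal_mul,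
      inv_mul_cancel₀ hb1.ne', Complex.ofReal_one, one_smul]
  obtain ⟨Q, hQ, hQc⟩ : ∃ Q : SuperOp A B, (b : ℂ) • choi Q = K ∧ IsCPTP Q := by
    rcases hb.eq_or_lt with rfl | hb
    -- When `b = 0` the matrix `K` vanishes and cannot be normalized; any channel can carry the zero
    -- weight.
    · refine ⟨P, ?_, hPc⟩
      have : K = 0 := by
        rw [← h.posSemidef.trace_eq_zero_iff, ← trace_partialTrace, h.partialTrace_eq]
        simp
      simp [this]
    · obtain ⟨Q, hQ⟩ := choi_surjective (((b⁻¹ : ℝ) : ℂ) • K)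
      have hb0 : (b : ℂ) ≠ 0 := by exact_mod_cast hb.ne'
      refine ⟨Q, by simp [hQ, hb0], ?_⟩
      rw [isCPTP_iff, hQ]
      refine ⟨h.posSemidef.smul (Complex.zero_le_real.2 (by positivity)), ?_⟩
      rw [map_smul, h.partialTrace_eq, smul_smul, ← Complex.ofReal_mul, inv_mul_cancel₀ hb.ne',
        Complex.ofReal_one, one_smul]
  have hdec : N = ∑ i : Bool, ((cond i (1 + b) (-b) : ℝ) : ℂ) • cond i P Q := by
    apply choi_injective
    rw [Fintype.sum_bool]
    simp only [cond_true, cond_false, map_add, map_smul, Complex.ofReal_neg, neg_smul, hQ, hP]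
    rw [smul_smul, ← Complex.ofReal_mul, mul_inv_cancel₀ hb1.ne']
    simp
  have := sum_abs_mem_decompositionCosts (fun i : Bool => cond i (1 + b) (-b))
    (fun i => cond i P Q) (by rintro (_ | _) <;> assumption)
  rw [← hdec, Fintype.sum_bool] at this
  simp only [cond_true, cond_false, abs_neg, abs_of_nonneg hb,
    abs_of_pos hb1] at this
  convert this using 1
  ring

section Norm

open scoped Matrix.Norms.L2Operator

theorem exists_isNegativePart (hJ : J.IsHermitian) : ∃ K b, IsNegativePart J K b := by
  refine ⟨((‖J‖ : ℝ) : ℂ) • 1, ‖J‖ * Fintype.card B, PosSemidef.one.smul (by simp), ?_, ?_⟩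
  · have := hJ.neg.posSemidef_smul_one_sub (norm_neg J).le
    rwa [sub_neg_eq_add] at this
  · ext a a'
    simp [partialTrace_apply, one_apply, mul_comm]

/-- The weight is recovered from the trace as `tr K / card A`, which turns the existential over `b`
into a closed condition on `K`. -/
theorem isClosed_setOf_isNegativePart [Nonempty A] :
    IsClosed {K : Matrix (A × B) (A × B) ℂ | ∃ b, IsNegativePart J K b} := by
  have hc : Continuous (partialTrace (A := A) (B := B)) := LinearMap.continuous_of_finiteDimensional _
  have : {K : Matrix (A × B) (A × B) ℂ | ∃ b, IsNegativePart J K b} =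
      {K | K.PosSemidef} ∩ (fun K => K + J) ⁻¹' {K | K.PosSemidef} ∩
      {K | partialTrace K = ((K.trace.re / Fintype.card A : ℝ) : ℂ) • (1 : Matrix A A ℂ)} := by
    ext K
    constructor
    · rintro ⟨b, h⟩
      refine ⟨⟨h.posSemidef, h.posSemidef_add⟩, ?_⟩
      rw [Set.mem_ofPred_eq, h.re_trace, mul_div_cancel_right₀ _ (by simp), h.partialTrace_eq]
    · rintro ⟨⟨h1, h2⟩, h3⟩
      exact ⟨_, h1, h2, h3⟩
  rw [this]
  refine (isClosed_setOf_posSemidef.inter (isClosed_setOf_posSemidef.preimage (by fun_prop))).inter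
    (isClosed_eq hc ?_)
  have : Continuous fun K : Matrix (A × B) (A × B) ℂ => K.trace := by fun_prop
  fun_prop

/-- Minimizing `b` is minimizing `tr K`. The trace dominates the norm on positive semidefinite
matrices, so sublevel sets are compact. -/
theorem exists_isNegativePart_forall_le [Nonempty A] (hJ : J.IsHermitian) :
    ∃ K b, IsNegativePart J K b ∧ ∀ K' b', IsNegativePart J K' b' → b ≤ b' := by
  obtain ⟨K₀, b₀, h₀⟩ := exists_isNegativePart hJ
  set F := {K : Matrix (A × B) (A × B) ℂ | ∃ b, IsNegativePart J K b}
  have ht : Continuous fun K : Matrix (A × B) (A × B) ℂ => K.trace.re :=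
    Complex.continuous_re.comp (by fun_prop)
  have hcpt : IsCompact (F ∩ {K | K.trace.re ≤ K₀.trace.re}) := by
    refine Metric.isCompact_of_isClosed_isBounded
      (isClosed_setOf_isNegativePart.inter (isClosed_le ht continuous_const)) ?_
    refine (Metric.isBounded_closedBall (x := 0) (r := K₀.trace.re)).subset ?_
    rintro K ⟨⟨b, h⟩, hK⟩
    rw [mem_closedBall_zero_iff]
    exact h.posSemidef.norm_le_trace.trans hK
  obtain ⟨K, ⟨⟨b, hK⟩, hK'⟩, hmin⟩ := hcpt.exists_isMinOn ⟨K₀, ⟨b₀, h₀⟩, le_refl K₀.trace.re⟩ ht.continuousOn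
  refine ⟨K, b, hK, fun K' b' h' => ?_⟩
  have hle : K.trace.re ≤ K'.trace.re := by
    by_cases hc : K'.trace.re ≤ K₀.trace.re
    · exact hmin ⟨⟨b', h'⟩, hc⟩
    · exact hK'.trans (not_le.1 hc).le
  rw [hK.re_trace, h'.re_trace] at hle
  exact le_of_mul_le_mul_right hle (by exact_mod_cast Fintype.card_pos)

end Norm

theorem exists_isLeast_decompositionCosts [Nonempty A] {N : SuperOp A B} (hN : IsHPTP N) :
    ∃ K b, IsNegativePart (choi N) K b ∧ (∀ K' b', IsNegativePart (choi N) K' b' → b ≤ b') ∧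
      IsLeast (decompositionCosts N) (1 + 2 * b) := by
  obtain ⟨K, b, h, hmin⟩ := exists_isNegativePart_forall_le hN.1.isHermitian_choi
  refine ⟨K, b, h, hmin, h.mem_decompositionCosts hN.2, fun c hc => ?_⟩
  obtain ⟨K', b', h', rfl⟩ := exists_isNegativePart_of_mem_decompositionCosts hN.2 hc
  linarith [hmin _ _ h']

end NegativePart

/-! ### Dual certificates by separation -/

section Duality

variable {A B : Type*} [Fintype A] [DecidableEq A] [Fintype B] [DecidableEq B]

variable {J : Matrix (A × B) (A × B) ℂ}

theorem exists_isNegativePart_of_posSemidef_sub [Nonempty B] {K : Matrix (A × B) (A × B) ℂ} {b : ℝ}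
    (hK : K.PosSemidef) (hKJ : (K + J).PosSemidef)
    (hb : ((b : ℂ) • (1 : Matrix A A ℂ) - partialTrace K).PosSemidef) :
    ∃ K', IsNegativePart J K' b := by
  -- The missing partial trace is restored by spreading the deficit uniformly over the `B` factor.
  set L : Matrix (A × B) (A × B) ℂ := (((Fintype.card B : ℝ)⁻¹ : ℝ) : ℂ) •
    (((b : ℂ) • (1 : Matrix A A ℂ) - partialTrace K) ⊗ₖ (1 : Matrix B B ℂ))
  have hL : L.PosSemidef :=
    (hb.kronecker PosSemidef.one).smul (Complex.zero_le_real.2 (by positivity))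
  refine ⟨K + L, hK.add hL, ?_, ?_⟩
  · rw [add_right_comm]; exact hKJ.add hL
  · rw [map_add, map_smul, partialTrace_kronecker_one, smul_smul]
    simp

section Norm

open scoped Matrix.Norms.L2Operator

theorem exists_posDef_forall_lt_trace_mul [Nonempty B] (hJ : J.IsHermitian) {v b : ℝ} (hv : v < b)
    (hb : ∀ K' b', IsNegativePart J K' b' → b ≤ b') :
    ∃ R : Matrix A A ℂ, R.PosDef ∧ ∀ K : Matrix (A × B) (A × B) ℂ, K.PosSemidef →
      (K + J).PosSemidef → v * R.trace.re < (partialTrace K * R).trace.re := by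
  -- `C` is the upward closure of the feasible partial traces; upward closedness is what will make
  -- the separating matrix positive semidefinite.
  let C : Set (Matrix A A ℂ) := {X | ∃ K : Matrix (A × B) (A × B) ℂ, K.PosSemidef ∧
    (K + J).PosSemidef ∧ (X - partialTrace K).PosSemidef}
  have hC : Convex ℝ C := by
    rintro X ⟨K, hK, hKJ, hX⟩ Y ⟨L, hL, hLJ, hY⟩ s t hs ht hst
    refine ⟨s • K + t • L, (hK.smul hs).add (hL.smul ht), ?_, ?_⟩
    · have : s • K + t • L + J = s • (K + J) + t • (L + J) := by
        nth_rw 1 [← one_smul ℝ J, ← hst]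
        module
      rw [this]
      exact (hKJ.smul hs).add (hLJ.smul ht)
    · have : s • X + t • Y - partialTrace (s • K + t • L) =
          s • (X - partialTrace K) + t • (Y - partialTrace L) := by
        rw [map_add, ← Complex.coe_smul s K, ← Complex.coe_smul t L, map_smul, map_smul,
          Complex.coe_smul, Complex.coe_smul]
        module
      rw [this]
      exact (hX.smul hs).add (hY.smul ht)
  -- A point of `C` within `(b - v) / 2` of `v • 1` would yield a negative part of weight `(b + v) /
  -- 2 < b`.
  have hvC : (v : ℂ) • (1 : Matrix A A ℂ) ∉ closure C := by
    intro h
    obtain ⟨X, ⟨K, hK, hKJ, hX⟩, hd⟩ :=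
      Metric.mem_closure_iff.1 h ((b - v) / 2) (by linarith)
    have hXh : X.IsHermitian := by
      simpa using hX.isHermitian.add hK.partialTrace.isHermitian
    have h1 : (X - (v : ℂ) • (1 : Matrix A A ℂ)).IsHermitian :=
      hXh.sub (by simp [IsHermitian])
    rw [dist_comm, dist_eq_norm] at hd
    have h2 := (h1.posSemidef_smul_one_sub hd.le).add hX
    obtain ⟨K', hK'⟩ := exists_isNegativePart_of_posSemidef_sub (J := J) (K := K)
      (b := (b - v) / 2 + v) hK hKJ (by
        convert h2 using 1
        rw [Complex.ofReal_add, add_smul]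
        abel)
    linarith [hb _ _ hK']
  obtain ⟨f, u, hfv, hfC⟩ := RCLike.geometric_hahn_banach_point_closed (𝕜 := ℂ) hC.closure
    isClosed_closure hvC
  obtain ⟨R, hR, hfR⟩ := exists_isHermitian_re_eq_re_trace_mul f.toLinearMap
  have hu : ∀ K : Matrix (A × B) (A × B) ℂ, K.PosSemidef → (K + J).PosSemidef →
      ∀ P : Matrix A A ℂ, P.PosSemidef →
        u < (partialTrace K * R).trace.re + (P * R).trace.re := fun K hK hKJ P hP => by
    have h1 := hfC (partialTrace K + P)
      (subset_closure ⟨K, hK, hKJ, by rwa [add_sub_cancel_left]⟩)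
    have h2 := hfR _ (hK.partialTrace.add hP).isHermitian
    rw [Matrix.add_mul, trace_add, Complex.add_re] at h2
    exact h1.trans_eq h2
  have huv : v * R.trace.re < u := by
    have h2 := hfR ((v : ℂ) • 1) (by simp [IsHermitian])
    rw [Matrix.smul_mul, Matrix.one_mul, trace_smul, smul_eq_mul, Complex.re_ofReal_mul] at h2
    exact h2.symm.trans_lt hfv
  have hRpos : R.PosSemidef := by
    obtain ⟨K, b', hK⟩ := exists_isNegativePart hJ
    refine hR.posSemidef_of_re_trace_mul_nonneg fun P hP => ?_
    rw [trace_mul_comm]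
    by_contra! hneg
    set x := (P * R).trace.re
    set y := (partialTrace K * R).trace.re
    have h0 := hu K hK.posSemidef hK.posSemidef_add 0 PosSemidef.zero
    -- This multiple of `P` would bring the functional down to exactly `u`, against the strict
    -- bound.
    have ht : 0 ≤ (y - u) / (-x) := by
      apply div_nonneg _ (by linarith)
      simp at h0; linarith
    have h1 := hu K hK.posSemidef hK.posSemidef_add _ (hP.smul (Complex.zero_le_real.2 ht))
    rw [Matrix.smul_mul, trace_smul, smul_eq_mul, Complex.re_ofReal_mul] at h1
    have : (y - u) / (-x) * x = u - y := by
      field_simp [hneg.ne]; ring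
    linarith
  set d := (Fintype.card A : ℝ) with hd_def
  have hd : 0 ≤ d := Nat.cast_nonneg _
  -- Small enough that making `R` definite uses up less than the separation gap: the loss is at most
  -- `ε * |v| * d`.
  set ε : ℝ := (u - v * R.trace.re) / (|v| * d + 1)
  have hε : 0 < ε := div_pos (by linarith) (by positivity)
  refine ⟨R + (ε : ℂ) • 1, PosDef.posSemidef_add hRpos
    (PosDef.one.smul (Complex.zero_lt_real.2 hε)), fun K hK hKJ => ?_⟩
  have h1 : (R + (ε : ℂ) • (1 : Matrix A A ℂ)).trace.re = R.trace.re + ε * d := by simp [d]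
  have h2 : (partialTrace K * (R + (ε : ℂ) • 1)).trace.re =
      (partialTrace K * R).trace.re + ε * (partialTrace K).trace.re := by
    rw [Matrix.mul_add, trace_add, Matrix.mul_smul, Matrix.mul_one, trace_smul, smul_eq_mul,
      Complex.add_re, Complex.re_ofReal_mul]
  have h3 := hu K hK hKJ 0 PosSemidef.zero
  have h4 : 0 ≤ ε * (partialTrace K).trace.re :=
    mul_nonneg hε.le (Complex.nonneg_iff.1 hK.partialTrace.trace_nonneg).1
  have h5 : ε * (|v| * d + 1) = u - v * R.trace.re :=
    div_mul_cancel₀ _ (by positivity)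
  have h6 : v * d * ε ≤ |v| * d * ε := by gcongr; exact le_abs_self v
  simp at h3
  rw [h1, h2]
  nlinarith

end Norm

/-- Write `R = Gᴴ * G`, `S = G ⊗ 1`, and let `S * J * Sᴴ = P - Q` have sign `U`. Then `W = Sᴴ * U *
S` lies between `∓ R ⊗ 1` and `tr (J W) = tr P + tr Q = tr R + 2 tr Q`, so it remains to see that
`tr Q > v tr R`. -/
theorem exists_witness_of_forall_lt_trace_mul (hJ : J.IsHermitian) (hJ1 : partialTrace J = 1)
    {v : ℝ} {R : Matrix A A ℂ} (hR : R.PosDef)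
    (h : ∀ K : Matrix (A × B) (A × B) ℂ, K.PosSemidef →
      (K + J).PosSemidef → v * R.trace.re < (partialTrace K * R).trace.re) :
    ∃ W : Matrix (A × B) (A × B) ℂ, (R ⊗ₖ (1 : Matrix B B ℂ) - W).PosSemidef ∧
      (R ⊗ₖ (1 : Matrix B B ℂ) + W).PosSemidef ∧ (1 + 2 * v) * R.trace.re < (J * W).trace.re := by
  obtain ⟨G, hG⟩ := hR.posSemidef.exists_eq_conjTranspose_mul_self
  have hGu : IsUnit G.det := by
    have := (isUnit_iff_isUnit_det _).1 hR.isUnit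
    rw [hG, det_mul] at this
    exact isUnit_of_mul_isUnit_right this
  set S : Matrix (A × B) (A × B) ℂ := G ⊗ₖ 1
  set T : Matrix (A × B) (A × B) ℂ := G⁻¹ ⊗ₖ 1
  have hTS : T * S = 1 := by
    rw [← mul_kronecker_mul, nonsing_inv_mul _ hGu, Matrix.one_mul, one_kronecker_one]
  have hST : S * T = 1 := by
    rw [← mul_kronecker_mul, mul_nonsing_inv _ hGu, Matrix.one_mul, one_kronecker_one]
  have hTS' : Sᴴ * Tᴴ = 1 := by rw [← conjTranspose_mul, hTS, conjTranspose_one]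
  have hST' : Tᴴ * Sᴴ = 1 := by rw [← conjTranspose_mul, hST, conjTranspose_one]
  have hSS : R ⊗ₖ (1 : Matrix B B ℂ) = Sᴴ * S := by
    rw [conjTranspose_kronecker, ← mul_kronecker_mul, ← hG, conjTranspose_one, Matrix.one_mul]
  obtain ⟨P, Q, U, hP, hQ, hU, hU', hK, hKU⟩ :=
    (isHermitian_mul_mul_conjTranspose S hJ).exists_jordan_decomposition
  have hTJ : T * (S * J * Sᴴ) * Tᴴ = J := by
    calc _ = (T * S) * J * (Sᴴ * Tᴴ) := by simp only [Matrix.mul_assoc]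
      _ = J := by rw [hTS, hTS', Matrix.one_mul, Matrix.mul_one]
  have hTQ : (T * Q * Tᴴ * (Sᴴ * S)).trace = Q.trace := by
    calc _ = (T * Q * (Tᴴ * Sᴴ) * S).trace := by simp only [Matrix.mul_assoc]
      _ = ((S * T) * Q).trace := by
        rw [hST', Matrix.mul_one, trace_mul_comm, Matrix.mul_assoc]
      _ = Q.trace := by rw [hST, Matrix.one_mul]
  have hPQ : P.trace - Q.trace = R.trace := by
    rw [← trace_sub, ← hK, Matrix.mul_assoc, trace_mul_comm, Matrix.mul_assoc, ← hSS,
      trace_mul_kronecker_one, hJ1, Matrix.one_mul]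
  have hJW : (J * (Sᴴ * U * S)).trace = P.trace + Q.trace := by
    rw [← hKU, ← Matrix.mul_assoc, trace_mul_comm]
    simp only [Matrix.mul_assoc]
  -- `T * Q * Tᴴ` is feasible because adding `J` to it leaves `T * P * Tᴴ`; its pairing with `R ⊗ 1`
  -- is `tr Q`.
  have hlt := h (T * Q * Tᴴ) (hQ.mul_mul_conjTranspose_same T) (by
    nth_rw 1 [← hTJ]
    rw [hK, ← Matrix.add_mul, ← Matrix.mul_add, add_sub_cancel]
    exact hP.mul_mul_conjTranspose_same T)
  rw [← trace_mul_kronecker_one, hSS, hTQ] at hlt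
  refine ⟨Sᴴ * U * S, ?_, ?_, ?_⟩
  · rw [hSS]
    convert hU.conjTranspose_mul_mul_same S using 1
    rw [Matrix.mul_sub, Matrix.sub_mul, Matrix.mul_one]
  · rw [hSS]
    convert hU'.conjTranspose_mul_mul_same S using 1
    rw [Matrix.mul_add, Matrix.add_mul, Matrix.mul_one]
  · have := congrArg Complex.re hPQ
    rw [Complex.sub_re] at this
    rw [hJW, Complex.add_re]
    linarith

end Duality

/-! ### Products of decompositions and of certificates -/

section Tensor

/-- Each combination is half a sum of two Kronecker products of the positive semidefinite factors `X
± Y` and `X' ± Y'`. -/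
theorem posSemidef_kronecker_sub_and_add {m n : Type*} [Fintype m] [Fintype n]
    {X Y : Matrix m m ℂ} {X' Y' : Matrix n n ℂ} (h₁ : (X - Y).PosSemidef)
    (h₂ : (X + Y).PosSemidef) (h₁' : (X' - Y').PosSemidef) (h₂' : (X' + Y').PosSemidef) :
    (X ⊗ₖ X' - Y ⊗ₖ Y').PosSemidef ∧ (X ⊗ₖ X' + Y ⊗ₖ Y').PosSemidef := by
  have hhalf : (0 : ℂ) ≤ ((1 / 2 : ℝ) : ℂ) := Complex.zero_le_real.2 (by norm_num)
  constructor
  · have h : X ⊗ₖ X' - Y ⊗ₖ Y' =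
        ((1 / 2 : ℝ) : ℂ) • ((X - Y) ⊗ₖ (X' + Y') + (X + Y) ⊗ₖ (X' - Y')) := by
      ext i j
      simp
      ring
    rw [h]
    exact ((h₁.kronecker h₂').add (h₂.kronecker h₁')).smul hhalf
  · have h : X ⊗ₖ X' + Y ⊗ₖ Y' =
        ((1 / 2 : ℝ) : ℂ) • ((X - Y) ⊗ₖ (X' - Y') + (X + Y) ⊗ₖ (X' + Y')) := by
      ext i j
      simp
      ring
    rw [h]
    exact ((h₁.kronecker h₁').add (h₂.kronecker h₂')).smul hhalf

theorem IsTracePreserving.nonempty {A B : Type*} [Fintype A] [Fintype B] [Nonempty A]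
    {N : SuperOp A B} (hN : IsTracePreserving N) : Nonempty B := by
  classical
  by_contra hB
  rw [not_nonempty_iff] at hB
  have := hN 1
  rw [trace_one, trace_eq_zero_of_isEmpty] at this
  exact Fintype.card_ne_zero (Nat.cast_eq_zero.1 this.symm)

/-- A dual certificate: `W` pairs with the Choi matrix of `N` to more than `v * tr R`, and with that
of each channel to at most `tr R` in absolute value. -/
theorem IsHPTP.exists_witness {A B : Type*} [Fintype A] [DecidableEq A] [Fintype B] [DecidableEq B]
    [Nonempty A] {N : SuperOp A B} (hN : IsHPTP N) {v m : ℝ}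
    (hm : IsLeast (decompositionCosts N) m) (hv : v < m) :
    ∃ (R : Matrix A A ℂ) (W : Matrix (A × B) (A × B) ℂ), R.PosDef ∧
      (R ⊗ₖ (1 : Matrix B B ℂ) - W).PosSemidef ∧ (R ⊗ₖ (1 : Matrix B B ℂ) + W).PosSemidef ∧
      v * R.trace.re < (choi N * W).trace.re := by
  have := hN.2.nonempty
  obtain ⟨K, b, -, hmin, hb⟩ := exists_isLeast_decompositionCosts hN
  obtain rfl := hm.unique hb
  obtain ⟨R, hR, h⟩ := exists_posDef_forall_lt_trace_mul (v := (v - 1) / 2)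
    hN.1.isHermitian_choi (by linarith) hmin
  obtain ⟨W, h₁, h₂, hW⟩ := exists_witness_of_forall_lt_trace_mul hN.1.isHermitian_choi
    (isTracePreserving_iff.1 hN.2) hR h
  refine ⟨R, W, hR, h₁, h₂, ?_⟩
  convert hW using 2
  ring

variable {A₁ B₁ A₂ B₂ : Type*}
    [Fintype A₁] [DecidableEq A₁] [Fintype B₁] [DecidableEq B₁]
    [Fintype A₂] [DecidableEq A₂] [Fintype B₂] [DecidableEq B₂]

/-- Pairing of a map on a bipartite system with an operator on `(A₁ ⊗ B₁) ⊗ (A₂ ⊗ B₂)`, through the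
Choi matrix. -/
noncomputable def choiPairing (W : Matrix ((A₁ × B₁) × A₂ × B₂) ((A₁ × B₁) × A₂ × B₂) ℂ) :
    SuperOp (A₁ × A₂) (B₁ × B₂) →ₗ[ℂ] ℂ where
  toFun O := ((choi O).submatrix (Equiv.prodProdProdComm A₁ B₁ A₂ B₂)
    (Equiv.prodProdProdComm A₁ B₁ A₂ B₂) * W).trace
  map_add' X Y := by rw [map_add, submatrix_add, Pi.add_apply, Pi.add_apply, Matrix.add_mul, trace_add]
  map_smul' c X := by
    rw [map_smul, submatrix_smul, Pi.smul_apply, Pi.smul_apply, Matrix.smul_mul, trace_smul]; rfl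

theorem choiPairing_tensorMap (M : SuperOp A₁ B₁) (N : SuperOp A₂ B₂)
    (W₁ : Matrix (A₁ × B₁) (A₁ × B₁) ℂ) (W₂ : Matrix (A₂ × B₂) (A₂ × B₂) ℂ) :
    choiPairing (W₁ ⊗ₖ W₂) (tensorMap M N) = (choi M * W₁).trace * (choi N * W₂).trace := by
  rw [← trace_kronecker, mul_kronecker_mul, choi_tensorMap]
  rfl

theorem choiPairing_kronecker_one {O : SuperOp (A₁ × A₂) (B₁ × B₂)} (hO : IsTracePreserving O)
    (R₁ : Matrix A₁ A₁ ℂ) (R₂ : Matrix A₂ A₂ ℂ) :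
    choiPairing ((R₁ ⊗ₖ (1 : Matrix B₁ B₁ ℂ)) ⊗ₖ (R₂ ⊗ₖ (1 : Matrix B₂ B₂ ℂ))) O =
      R₁.trace * R₂.trace := by
  have h : (R₁ ⊗ₖ (1 : Matrix B₁ B₁ ℂ)) ⊗ₖ (R₂ ⊗ₖ (1 : Matrix B₂ B₂ ℂ)) =
      ((R₁ ⊗ₖ R₂) ⊗ₖ (1 : Matrix (B₁ × B₂) (B₁ × B₂) ℂ)).submatrix
        (Equiv.prodProdProdComm A₁ B₁ A₂ B₂) (Equiv.prodProdProdComm A₁ B₁ A₂ B₂) := by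
    rw [← one_kronecker_one]
    ext i j
    exact mul_mul_mul_comm _ _ _ _
  simp only [choiPairing, LinearMap.coe_mk, AddHom.coe_mk]
  rw [h, submatrix_mul_equiv]
  have h' : ∀ X : Matrix ((A₁ × A₂) × B₁ × B₂) ((A₁ × A₂) × B₁ × B₂) ℂ,
      (X.submatrix (Equiv.prodProdProdComm A₁ B₁ A₂ B₂)
        (Equiv.prodProdProdComm A₁ B₁ A₂ B₂)).trace = X.trace := fun X =>
    (Equiv.prodProdProdComm A₁ B₁ A₂ B₂).sum_comp fun i => X i i
  rw [h', trace_mul_kronecker_one, isTracePreserving_iff.1 hO, Matrix.one_mul, trace_kronecker]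

/-- Weak duality: pair the positive semidefinite Choi matrix of `O` with both operator inequalities.
-/
theorem abs_re_choiPairing_le {O : SuperOp (A₁ × A₂) (B₁ × B₂)} (hO : IsCPTP O)
    {R₁ : Matrix A₁ A₁ ℂ} {R₂ : Matrix A₂ A₂ ℂ}
    {W : Matrix ((A₁ × B₁) × A₂ × B₂) ((A₁ × B₁) × A₂ × B₂) ℂ}
    (h₁ : ((R₁ ⊗ₖ (1 : Matrix B₁ B₁ ℂ)) ⊗ₖ (R₂ ⊗ₖ (1 : Matrix B₂ B₂ ℂ)) - W).PosSemidef)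
    (h₂ : ((R₁ ⊗ₖ (1 : Matrix B₁ B₁ ℂ)) ⊗ₖ (R₂ ⊗ₖ (1 : Matrix B₂ B₂ ℂ)) + W).PosSemidef) :
    |(choiPairing W O).re| ≤ (R₁.trace * R₂.trace).re := by
  have hJ := (isCompletelyPositive_iff.1 hO.1).submatrix (Equiv.prodProdProdComm A₁ B₁ A₂ B₂)
  have e₁ := hJ.re_trace_mul_nonneg h₁
  have e₂ := hJ.re_trace_mul_nonneg h₂
  rw [Matrix.mul_sub, trace_sub, Complex.sub_re] at e₁
  rw [Matrix.mul_add, trace_add, Complex.add_re] at e₂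
  rw [← choiPairing_kronecker_one hO.2, abs_le]
  simp only [choiPairing, LinearMap.coe_mk, AddHom.coe_mk]
  exact ⟨by linarith, by linarith⟩

theorem mul_mem_decompositionCosts_tensorMap {M : SuperOp A₁ B₁} {N : SuperOp A₂ B₂} {c d : ℝ}
    (hc : c ∈ decompositionCosts M) (hd : d ∈ decompositionCosts N) :
    c * d ∈ decompositionCosts (tensorMap M N) := by
  obtain ⟨m, η, O, hO, rfl, rfl⟩ := hc
  obtain ⟨n, θ, P, hP, rfl, rfl⟩ := hd
  have h := sum_abs_mem_decompositionCosts (fun i : Fin m × Fin n => η i.1 * θ i.2)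
    (fun i => tensorMap (O i.1) (P i.2)) fun i => (hO i.1).tensorMap (hP i.2)
  have hMN : tensorMap (∑ i, (η i : ℂ) • O i) (∑ j, (θ j : ℂ) • P j) =
      ∑ i : Fin m × Fin n, ((η i.1 * θ i.2 : ℝ) : ℂ) • tensorMap (O i.1) (P i.2) := by
    refine LinearMap.ext fun X => ?_
    simp only [tensorMap, ← TensorProduct.mapBilinear_apply, map_sum, map_smul,
      LinearMap.sum_apply, LinearMap.smul_apply, LinearMap.comp_apply, Fintype.sum_prod_type,
      Finset.smul_sum, smul_smul, Complex.ofReal_mul]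
    rw [Finset.sum_comm]
    simp only [mul_comm]
  rw [hMN]
  convert h using 1
  simp only [Fintype.sum_prod_type, Finset.sum_mul_sum, abs_mul]

theorem mul_le_of_mem_decompositionCosts_tensorMap [Nonempty A₁] [Nonempty A₂]
    {M : SuperOp A₁ B₁} {N : SuperOp A₂ B₂} (hM : IsHPTP M) (hN : IsHPTP N) {m n c : ℝ}
    (hm : IsLeast (decompositionCosts M) m) (hn : IsLeast (decompositionCosts N) n) (hm0 : 0 ≤ m)
    (hc : c ∈ decompositionCosts (tensorMap M N)) : m * n ≤ c := by
  obtain ⟨k, η, O, hO, hMN, rfl⟩ := hc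
  -- Certificates are available only strictly below each minimum, so the product bound is reached
  -- through all nonnegative `v < m`, `w < n`.
  refine mul_le_of_forall_lt_of_nonneg hm0 (by positivity) fun v hv hvm w hw hwn => ?_
  obtain ⟨R₁, W₁, hR₁, h₁, h₁', hv'⟩ := hM.exists_witness hm hvm
  obtain ⟨R₂, W₂, hR₂, h₂, h₂', hw'⟩ := hN.exists_witness hn hwn
  have hW₁ : W₁.IsHermitian := by
    simpa using h₁'.isHermitian.sub (hR₁.posSemidef.kronecker .one).isHermitian
  have hW₂ : W₂.IsHermitian := by
    simpa using h₂'.isHermitian.sub (hR₂.posSemidef.kronecker .one).isHermitian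
  obtain ⟨hW, hW'⟩ := posSemidef_kronecker_sub_and_add h₁ h₁' h₂ h₂'
  have hr₁ : 0 < R₁.trace.re := (Complex.pos_iff.1 hR₁.trace_pos).1
  have hr₂ : 0 < R₂.trace.re := (Complex.pos_iff.1 hR₂.trace_pos).1
  have hr : (R₁.trace * R₂.trace).re = R₁.trace.re * R₂.trace.re := by
    rw [← hR₁.posSemidef.coe_re_trace, Complex.re_ofReal_mul, Complex.ofReal_re]
  have hprod : (choiPairing (W₁ ⊗ₖ W₂) (tensorMap M N)).re =
      (choi M * W₁).trace.re * (choi N * W₂).trace.re := by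
    rw [choiPairing_tensorMap, ← hM.1.isHermitian_choi.coe_re_trace_mul hW₁, Complex.re_ofReal_mul,
      Complex.ofReal_re]
  have hle : (choiPairing (W₁ ⊗ₖ W₂) (tensorMap M N)).re ≤
      (∑ α, |η α|) * (R₁.trace.re * R₂.trace.re) := by
    rw [hMN, map_sum, Complex.re_sum, Finset.sum_mul]
    refine Finset.sum_le_sum fun α _ => ?_
    rw [map_smul, smul_eq_mul, Complex.re_ofReal_mul, ← hr]
    refine (le_abs_self _).trans ?_
    rw [abs_mul]
    exact mul_le_mul_of_nonneg_left (abs_re_choiPairing_le (hO α) hW hW') (abs_nonneg _)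
  refine le_of_mul_le_mul_right (le_trans ?_ hle) (mul_pos hr₁ hr₂)
  rw [hprod]
  calc v * w * (R₁.trace.re * R₂.trace.re) = (v * R₁.trace.re) * (w * R₂.trace.re) := by ring
    _ ≤ _ := mul_le_mul hv'.le hw'.le (by positivity) ((mul_nonneg hv hr₁.le).trans hv'.le)

theorem two_rpow_physicalImplementability {A B : Type*} [Fintype A] [DecidableEq A] [Fintype B]
    [DecidableEq B] {N : SuperOp A B} {m : ℝ} (hm : IsLeast (decompositionCosts N) m)
    (hm0 : 0 < m) : (2 : ℝ) ^ physicalImplementability N = m := by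
  rw [physicalImplementability, hm.csInf_eq, Real.rpow_logb (by norm_num) (by norm_num) hm0]

end Tensor

end LinearMapImplementability

theorem mainTheorem1 {A₁ B₁ A₂ B₂ : Type*}
    [Fintype A₁] [DecidableEq A₁] [Nonempty A₁] [Fintype B₁] [DecidableEq B₁]
    [Fintype A₂] [DecidableEq A₂] [Nonempty A₂] [Fintype B₂] [DecidableEq B₂]
    (M : LinearMapImplementability.SuperOp A₁ B₁) (N : LinearMapImplementability.SuperOp A₂ B₂)
    (hM : LinearMapImplementability.IsHPTP M) (hN : LinearMapImplementability.IsHPTP N) :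
    -- the minima that define the three values of `ν` exist, and `ν` is their logarithm
    (IsLeast (LinearMapImplementability.decompositionCosts M)
        ((2 : ℝ) ^ LinearMapImplementability.physicalImplementability M) ∧
      IsLeast (LinearMapImplementability.decompositionCosts N)
        ((2 : ℝ) ^ LinearMapImplementability.physicalImplementability N) ∧
      IsLeast (LinearMapImplementability.decompositionCosts
          (LinearMapImplementability.tensorMap M N))
        ((2 : ℝ) ^ LinearMapImplementability.physicalImplementability
          (LinearMapImplementability.tensorMap M N))) ∧
    -- additivity
    LinearMapImplementability.physicalImplementability
        (LinearMapImplementability.tensorMap M N) =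
      LinearMapImplementability.physicalImplementability M +
        LinearMapImplementability.physicalImplementability N := by
  open LinearMapImplementability in
  obtain ⟨K, b, hK, -, hm⟩ := exists_isLeast_decompositionCosts hM
  obtain ⟨L, d, hL, -, hn⟩ := exists_isLeast_decompositionCosts hN
  have hm0 : 0 < 1 + 2 * b := by linarith [hK.nonneg]
  have hn0 : 0 < 1 + 2 * d := by linarith [hL.nonneg]
  have hmn : IsLeast (decompositionCosts (tensorMap M N)) ((1 + 2 * b) * (1 + 2 * d)) :=
    ⟨mul_mem_decompositionCosts_tensorMap hm.1 hn.1, fun c hc =>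
      mul_le_of_mem_decompositionCosts_tensorMap hM hN hm hn hm0.le hc⟩
  rw [two_rpow_physicalImplementability hm hm0, two_rpow_physicalImplementability hn hn0,
    two_rpow_physicalImplementability hmn (mul_pos hm0 hn0)]
  refine ⟨⟨hm, hn, hmn⟩, ?_⟩
  rw [physicalImplementability, physicalImplementability, physicalImplementability, hm.csInf_eq,
    hn.csInf_eq, hmn.csInf_eq, Real.logb_mul hm0.ne' hn0.ne']
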